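/- Let $d,D\in\mathbb N$, $a,b>0$, $\mu>0$, and let $\phi_{\bf P}$ be a complex tensor with ${\bf P}=(p_1,\dots,p_d)$, $p_s\in\mathbb Z^D$. Write $|p_s|^{2\xi}=\sum_{i=1}^D|p_{s,i}|^{2\xi}$ and ${\bf P}^{2\xi}=\sum_{s}|p_s|^{2\xi}$. In model $+$ let $\xi$ range over $a,b$, in model $\times$ over $a,2a,b$. *Graphs.* The vertices of a (finite) Feynman graph $\mathcal G$ are of the following kinds, with real couplings $\lambda,\eta,\delta_\mu,Z_\xi$. (i) Quartic vertices of color $s\in\{1,\dots,d\}$ with four fields contracted, for $s=1$, as $\phi_{12\dots d}\bar\phi_{1'2\dots d}\phi_{1'2'\dots d'}\bar\phi_{12'\dots d'}$ (and likewise for the other colors, with color $s$ in the role of color $1$), with weight $\lambda/2$ (ordinary) or enhanced. The enhanced weight is $\frac\eta2|p_s|^{2a}$ in model $+$, with one enhanced strand, the one carrying $p_s$; alternatively one takes the symmetrized weight $\frac\eta2(|p_s|^{2a}+|p_s'|^{2a})$, with two enhanced strands. It is $\frac\eta2|p_s|^{2a}|p'_s|^{2a}$ in model $\times$, with two enhanced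 strands. (ii) Quadratic vertices $\phi_{\bf P}\bar\phi_{\bf P}$ with weight $\delta_\mu$, or of type $(\xi,s)$ with weight $Z_\xi|p_s|^{2\xi}$. The vertex kernel ${\bf V}_v$ is the weight times the Kronecker deltas of the contraction. Lines join a field $\phi$ to a field $\bar\phi$, each field being on at most one line; the fields on no line are the external legs. A face of color $s$ of a subgraph is a component of the graph formed by its lines and the strands of color $s$ of the vertices; it is internal if it is closed (a cycle). *Slices.* For $M>1$ let $M_b=M^b$, and slice the propagator $\tilde C({\bf P})=1/(\sum_\xi{\bf P}^{2\xi}+\mu)=\sum_{i\ge0}C_i({\bf P})$ by $C_i({\bf P})=\int_{I_i}e^{-\alpha(\sum_\xi{\bf P}^{2\xi}+\mu)}d\alpha$ with $I_0=[M_b^{-2},\infty)$ and $I_i=[M_b^{-2(i+1)},M_b^{-2i}]$ for $i\ge1$. For a momentum assignment $\boldsymbol\mu=(i_l)_{l}$, $0\le i_l\le\Lambda$, the sliced amputated amplitude is $$A_{\mathcal G;\boldsymbol\mu}=\sum\ \prod_{l}C_{i_l}({\bf P}_{l})\,\delta_{{\bf P}_l,{\bf P}'_l}\ \prod_v(-{\bf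 V}_v),$$ where ${\bf P}_l,{\bf P}'_l$ are the momenta of the two fields joined by the line $l$ and the sum runs over the momenta of all fields that are not external legs, the momenta of the external legs being fixed. The quasi-local subgraphs $G^i_k$ are the connected components of the subgraph formed by the lines with $i_l\ge i$. *Degree.* For a subgraph $g$, let $L(g)$ and $F_{\rm int}(g)$ be its numbers of lines and of internal faces, $\rho_\bullet(g)$ ($\bullet=+,\times$) the number of times that its internal faces pass through enhanced strands of enhanced quartic vertices, $\rho_{2;\xi}(g)$ the number of times that its internal faces of color $s$, $s=1,\dots,d$, pass through quadratic vertices of type $(\xi,s)$, and $$\omega_{{\rm d};\bullet}(g)=-2b\,L(g)+D\,F_{\rm int}(g)+2a\,\rho_\bullet(g)+\sum_\xi2\xi\,\rho_{2;\xi}(g).$$ *Theorem.* Assume $a\le b$ for model $+$ (with either form of the enhanced weight), resp. $3a\le2b$ for model $\times$. Then for every graph $\mathcal G$ and every $R$ there is a constant $\kappa>0$, depending only on $\mathcal G$, $R$ and the parameters $d,D,a,b,\mu,M,\lambda,\eta,\delta_\mu,Z_\xi$, such that for all external momenta with components bounded by $R$ in absolute value, all $\Lambda$ and all momentum assignments $\boldsymbol\mu\in\{0,\dots,\Lambda\}^{L(\mathcal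 G)}$, the sum defining $A_{\mathcal G;\boldsymbol\mu}$ converges absolutely and $$|A_{\mathcal G;\boldsymbol\mu}|\le\kappa\prod_{i=0}^{\Lambda}\prod_kM^{\omega_{{\rm d};\bullet}(G^i_k)}.$$ -/

import Mathlib

noncomputable section

namespace EnhancedTensor

/-- The enhanced quartic models. In `plus` the quartic interaction of color `s` carries the weight
`|p_s|^{2a}` of one of its two strands of color `s`; in `plusSym` it carries the symmetrized weight
`|p_s|^{2a} + |p'_s|^{2a}`; in `times` it carries `|p_s|^{2a} |p'_s|^{2a}`. -/
inductive Model
  | plus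
  | plusSym
  | times
  deriving DecidableEq

/-- Labels of the exponents `ξ = a, 2a, b`. -/
inductive Xi
  | a
  | twoA
  | b
  deriving DecidableEq

/-- The numerical value of an exponent label. -/
def Xi.val (a b : ℝ) : Xi → ℝ
  | .a => a
  | .twoA => 2 * a
  | .b => b

/-- The exponents `ξ` of a model: `a, b` in the models `+`, and `a, 2a, b` in the model `×`. -/
def Model.exponents : Model → Finset Xi
  | .plus => {.a, .b}
  | .plusSym => {.a, .b}
  | .times => {.a, .twoA, .b}

/-- The condition on the exponents: `a ≤ b` for the models `+`, `3a ≤ 2b` for the model `×`. -/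
def Model.Condition (a b : ℝ) : Model → Prop
  | .plus => a ≤ b
  | .plusSym => a ≤ b
  | .times => 3 * a ≤ 2 * b

/-- The multi-index `P = (p_1, …, p_d)` of a rank `d` tensor, with `p_s ∈ ℤ^D`. -/
abbrev Mom (d D : ℕ) : Type := Fin d → Fin D → ℤ

/-- `|p|^{2ξ} = ∑_i |p_i|^{2ξ}` for `p ∈ ℤ^D`. -/
def normPow {D : ℕ} (ξ : ℝ) (p : Fin D → ℤ) : ℝ :=
  ∑ i, |(p i : ℝ)| ^ (2 * ξ)

/-- `∑_ξ P^{2ξ} + mass`, the symbol of the kinetic term, `P^{2ξ} = ∑_s |p_s|^{2ξ}`. -/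
def kinetic (m : Model) {d D : ℕ} (a b mass : ℝ) (P : Mom d D) : ℝ :=
  (∑ ξ ∈ m.exponents, ∑ s, normPow (ξ.val a b) (P s)) + mass

/-- Slice `i` of the Schwinger representation `1 / E = ∫_0^∞ e^{-α E} dα`, in the geometric
progression of ratio `M`: `α ∈ [M^{-2(i+1)}, M^{-2i}]` for `i ≥ 1`, and `α ≥ M^{-2}` for `i = 0`. -/
def slice (M : ℝ) (E : ℝ) : ℕ → ℝ
  | 0 => ∫ α in Set.Ioi (M ^ (-2 : ℤ)), Real.exp (-(α * E))
  | i + 1 => ∫ α in (M ^ (-2 * ((i : ℤ) + 2)))..(M ^ (-2 * ((i : ℤ) + 1))), Real.exp (-(α * E))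

/-- The kernel `C_{•;i}(P; P')` of the sliced propagator. -/
def slicedPropagator (m : Model) {d D : ℕ} (a b mass M : ℝ) (i : ℕ) (P P' : Mom d D) : ℝ :=
  if P = P' then slice M (kinetic m a b mass P) i else 0

/-- The coupling constants `λ`, `η`, `δ_μ`, `Z_ξ`. -/
structure Couplings where
  lam : ℝ
  eta : ℝ
  deltaMu : ℝ
  Z : Xi → ℝ

/-- The kinds of vertices of a graph: `V_{4;s}`, `V_{•;4;s}`, `V_2` and `V_{2;ξ;s}`. -/
inductive VertexKind (m : Model) (d : ℕ)
  | quartic (s : Fin d)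
  | enhanced (s : Fin d)
  | mass
  | two (ξ : Xi) (hξ : ξ ∈ m.exponents) (s : Fin d)

namespace VertexKind

variable {m : Model} {d : ℕ}

/-- The number of fields `φ` of the vertex, which is also its number of fields `φ̄`. -/
def arity : VertexKind m d → ℕ
  | quartic _ => 2
  | enhanced _ => 2
  | mass => 1
  | two _ _ _ => 1

/-- The edge of color `s` of the bubble joins the `j`-th white vertex (field `φ`) to the black
vertex (field `φ̄`) of index `strand k s j`. In the quartic bubble
`φ_{12…d} φ̄_{1'2…d} φ_{1'2'…d'} φ̄_{12'…d'}` (written for the distinguished color `1`) the fields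
are white 0, black 0, white 1, black 1. -/
def strand : (k : VertexKind m d) → Fin d → Fin k.arity → Fin k.arity
  | quartic c, s, j => if s = c then Fin.rev j else j
  | enhanced c, s, j => if s = c then Fin.rev j else j
  | mass, _, j => j
  | two _ _ _, _, j => j

/-- The coupling and the momentum weight of the vertex, as a function of the momenta of its
fields `φ`. -/
def weight {D : ℕ} (a b : ℝ) (g : Couplings) : (k : VertexKind m d) → (Fin k.arity → Mom d D) → ℝ
  | quartic _, _ => g.lam / 2
  | enhanced c, P => g.eta / 2 *
      match m with
      | .plus => normPow a (P (0 : Fin 2) c)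
      | .plusSym => normPow a (P (0 : Fin 2) c) + normPow a (P (1 : Fin 2) c)
      | .times => normPow a (P (0 : Fin 2) c) * normPow a (P (1 : Fin 2) c)
  | mass, _ => g.deltaMu
  | two ξ _ s, P => g.Z ξ * normPow (ξ.val a b) (P (0 : Fin 1) s)

open Classical in
/-- The vertex kernel: the weight times the Kronecker deltas along the edges of the bubble;
`P` and `P'` are the momenta of the fields `φ` and `φ̄`. -/
def kernel {D : ℕ} (a b : ℝ) (g : Couplings) (k : VertexKind m d)
    (P P' : Fin k.arity → Mom d D) : ℝ :=
  if ∀ s j, P j s = P' (k.strand s j) s then k.weight a b g P else 0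

/-- The edge of color `s` at the `j`-th white vertex of the bubble is one of the edges whose
momentum enhances the quartic vertex. -/
def IsEnhancedStrand : (k : VertexKind m d) → Fin d → Fin k.arity → Prop
  | enhanced c, s, j => s = c ∧
      match m with
      | .plus => j = (0 : Fin 2)
      | .plusSym => True
      | .times => True
  | quartic _, _, _ => False
  | mass, _, _ => False
  | two _ _ _, _, _ => False

/-- The vertex belongs to `V_{2;ξ;s}`. -/
def IsTwo (ξ : Xi) (s : Fin d) : VertexKind m d → Prop
  | two ξ' _ s' => ξ' = ξ ∧ s' = s
  | quartic _ => False
  | enhanced _ => False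
  | mass => False

end VertexKind

/-- A Feynman graph of the model: finitely many vertices, and finitely many propagator lines, each
of which joins a field `φ` (`src`) to a field `φ̄` (`tgt`); every field is on at most one line, and
the fields on no line are the external legs. -/
structure FeynmanGraph (m : Model) (d : ℕ) where
  V : Type
  L : Type
  [fintypeV : Fintype V]
  [fintypeL : Fintype L]
  kind : V → VertexKind m d
  src : L → Σ v : V, Fin (kind v).arity
  tgt : L → Σ v : V, Fin (kind v).arity
  src_injective : Function.Injective src
  tgt_injective : Function.Injective tgt

attribute [instance] FeynmanGraph.fintypeV FeynmanGraph.fintypeL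

namespace FeynmanGraph

variable {m : Model} {d : ℕ} (G : FeynmanGraph m d)

/-- Indices of the fields `φ` of all vertices; the fields `φ̄` have the same index set. -/
abbrev Corner : Type := Σ v : G.V, Fin (G.kind v).arity

/-- All fields of all vertices: `Sum.inl` for the fields `φ` (white), `Sum.inr` for the fields `φ̄`
(black). -/
abbrev Field : Type := G.Corner ⊕ G.Corner

/-- The field is on one of the lines of `T`. -/
def OnLine (T : Set G.L) : G.Field → Prop
  | .inl c => ∃ l ∈ T, G.src l = c
  | .inr c => ∃ l ∈ T, G.tgt l = c

/-- The external legs of the graph. -/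
def ExtLeg : Type := {x : G.Field // ¬ G.OnLine Set.univ x}

/-- Momenta of all fields that take the prescribed values on the external legs. -/
def Config {D : ℕ} (Pext : G.ExtLeg → Mom d D) : Type :=
  {P : G.Field → Mom d D // ∀ x : G.ExtLeg, P x.1 = Pext x}

/-- The summand of the sliced amplitude: the product of the sliced propagators over the lines and
of the kernels `-V_v` over the vertices. -/
def integrand {D : ℕ} (a b mass M : ℝ) (g : Couplings) (scale : G.L → ℕ)
    (P : G.Field → Mom d D) : ℝ :=
  (∏ l, slicedPropagator m a b mass M (scale l) (P (.inl (G.src l))) (P (.inr (G.tgt l)))) *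
    ∏ v, -(G.kind v).kernel a b g (fun j => P (.inl ⟨v, j⟩)) (fun j => P (.inr ⟨v, j⟩))

/-- The sliced (amputated) amplitude `A_{G;μ}`, at the momentum assignment `scale`. -/
def amplitude {D : ℕ} (a b mass M : ℝ) (g : Couplings) (scale : G.L → ℕ)
    (Pext : G.ExtLeg → Mom d D) : ℝ :=
  ∑' P : G.Config Pext, G.integrand a b mass M g scale P.1

/-- The graph on the fields whose edges are the lines in `T` (color `0`) and the bubble edges of
color `s`. -/
def bicolored (T : Set G.L) (s : Fin d) : SimpleGraph G.Field :=
  SimpleGraph.fromRel fun x y =>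
    (∃ l ∈ T, x = .inl (G.src l) ∧ y = .inr (G.tgt l)) ∨
      ∃ c : G.Corner, x = .inl c ∧ y = .inr ⟨c.1, (G.kind c.1).strand s c.2⟩

/-- Internal faces of the subgraph with line set `T`: a face of color `s` is a connected component
of the bicolored graph of colors `0` and `s`. Each field is on exactly one bubble edge of color `s`
and on at most one line, so the component is a cycle when all its fields are on lines of `T`, and an
open strand otherwise. -/
def IntFace (T : Set G.L) : Type :=
  Σ s : Fin d, {c : (G.bicolored T s).ConnectedComponent // ∀ x ∈ c.supp, G.OnLine T x}

instance (T : Set G.L) : Finite (G.IntFace T) := by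
  have h (s : Fin d) : Finite (G.bicolored T s).ConnectedComponent := Quot.finite _
  unfold IntFace
  infer_instance

instance (T : Set G.L) : Fintype (G.IntFace T) := Fintype.ofFinite _

/-- The number of times that the internal face passes through the enhanced edges of the enhanced
quartic vertices. -/
def rhoFace {T : Set G.L} (f : G.IntFace T) : ℕ :=
  Nat.card {c : G.Corner // (G.kind c.1).IsEnhancedStrand f.1 c.2 ∧ .inl c ∈ f.2.1.supp}

/-- The number of times that the internal face passes through vertices of `V_{2;ξ;s}`, where `s` is
the color of the face. -/
def rhoTwoFace (ξ : Xi) {T : Set G.L} (f : G.IntFace T) : ℕ :=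
  Nat.card {c : G.Corner // (G.kind c.1).IsTwo ξ f.1 ∧ .inl c ∈ f.2.1.supp}

/-- `ρ_•` of the subgraph with line set `T`. -/
def rho (T : Set G.L) : ℕ := ∑ f : G.IntFace T, G.rhoFace f

/-- `ρ_{2;ξ}` of the subgraph with line set `T`. -/
def rhoTwo (ξ : Xi) (T : Set G.L) : ℕ := ∑ f : G.IntFace T, G.rhoTwoFace ξ f

/-- The degree of divergence of the subgraph with line set `T`. -/
def degree (D : ℕ) (a b : ℝ) (T : Set G.L) : ℝ :=
  -2 * b * (Nat.card T : ℝ) + D * (Nat.card (G.IntFace T) : ℝ) + 2 * a * (G.rho T : ℝ) +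
    ∑ ξ ∈ m.exponents, 2 * ξ.val a b * (G.rhoTwo ξ T : ℝ)

/-- The line set of the subgraph `G^i`. -/
def highLines (scale : G.L → ℕ) (i : ℕ) : Set G.L := {l | i ≤ scale l}

/-- Adjacency of the vertices of the graph through the lines of `T`. -/
def lineGraph (T : Set G.L) : SimpleGraph G.V :=
  SimpleGraph.fromRel fun v w => ∃ l ∈ T, (G.src l).1 = v ∧ (G.tgt l).1 = w

/-- The index set of the connected components `G^i_k` of `G^i`. Vertices on no line of `G^i` count
as components without lines; their degree is `0`. -/
abbrev Component (scale : G.L → ℕ) (i : ℕ) : Type :=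
  (G.lineGraph (G.highLines scale i)).ConnectedComponent

instance (scale : G.L → ℕ) (i : ℕ) : Fintype (G.Component scale i) :=
  haveI : Finite (G.Component scale i) := Quot.finite _
  Fintype.ofFinite _

/-- The line set of the quasi-local subgraph `G^i_k`. -/
def componentLines (scale : G.L → ℕ) (i : ℕ) (k : G.Component scale i) : Set G.L :=
  {l | l ∈ G.highLines scale i ∧ (G.src l).1 ∈ k.supp}

end FeynmanGraph

end EnhancedTensor

end

noncomputable section
namespace EnhancedTensor

/-! ### Elementary estimates -/

/-! Multiscale power counting. The Kronecker deltas make the momentum of color `s` constant along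
each face of color `s`: on an open face it equals an external momentum, so it is bounded by `R`, and
on an internal face it is a free variable in `ℤ^D`.

With `n = i + 1`, a line of scale `i` is at most a constant times `M ^ (-2bn) ∏_s exp(-M ^ (-2bn)
|p_s|^{2b})` (`slice_kinetic_le`). For each internal face `f` only the decay of its line of lowest
scale `i_f` is kept, which is the strongest available; put `n_f = i_f + 1`. A weight `|q|^{2ξ}` on
`f` costs `M ^ (2ξ n_f)` and a small share of this exponential (`normPow_le_mul_exp`). All shares
together use at most half of it (`prod_cornerBound_le`), and the other half makes the sum over `q`
at most a constant times `M ^ (D n_f)` (`sum_exp_normPow_le`). The amplitude is thus bounded by a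
constant times `M` to the power `-2b ∑_l (i_l + 1) + ∑_f (i_f + 1)(D + faceExp f)`.

It remains to compare this exponent with the degrees (`sum_degree_ge`). A line `l` belongs to `G^i`
for exactly the `i_l + 1` values `i ≤ i_l`, and then to one component. A face `f` lies entirely in
`G^i` when `i ≤ i_f`, and being connected it is an internal face of a single component. Summing over
`i` bounds the exponent by the sum of the degrees of all `G^i_k`. -/

theorem rpow_le_mul_exp_rpow {ξ b δ : ℝ} (hξ : 0 < ξ) (hb : 0 < b) (hδ : 0 < δ) :
    ∃ C : ℝ, 1 ≤ C ∧ ∀ y : ℝ, 0 ≤ y → y ^ (2 * ξ) ≤ C * Real.exp (δ * y ^ (2 * b)) := by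
  obtain ⟨k, hk⟩ := exists_nat_ge (ξ / b)
  have hδr : 0 < δ ^ (-(ξ / b)) := Real.rpow_pos_of_pos hδ _
  refine ⟨1 + δ ^ (-(ξ / b)) * (1 + k.factorial), by
    have : 0 ≤ δ ^ (-(ξ / b)) * (1 + k.factorial) := by positivity
    linarith, fun y hy => ?_⟩
  -- In the variable `u` the claim is that `u ^ (ξ / b)` is dominated by `exp u`, which follows from
  -- `u ^ (ξ / b) ≤ 1 + u ^ k` and `u ^ k ≤ k! exp u`.
  set u : ℝ := δ * y ^ (2 * b) with hu
  have hu0 : 0 ≤ u := by positivity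
  have h1 : y ^ (2 * ξ) = δ ^ (-(ξ / b)) * u ^ (ξ / b) := by
    rw [hu, Real.mul_rpow hδ.le (by positivity), ← mul_assoc, ← Real.rpow_add hδ,
      neg_add_cancel, Real.rpow_zero, one_mul, ← Real.rpow_mul hy]
    congr 1
    field_simp
  have h2 : u ^ (ξ / b) ≤ 1 + u ^ k := by
    rcases le_total u 1 with h | h
    · have := Real.rpow_le_one hu0 h (by positivity : 0 ≤ ξ / b)
      have : 0 ≤ u ^ k := by positivity
      linarith
    · have := Real.rpow_le_rpow_of_exponent_le h hk
      rw [Real.rpow_natCast] at this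
      linarith
  have h3 : u ^ k ≤ k.factorial * Real.exp u := by
    have := Real.pow_div_factorial_le_exp u hu0 k
    rwa [div_le_iff₀ (by positivity), mul_comm] at this
  have h4 : 1 ≤ Real.exp u := Real.one_le_exp hu0
  rw [h1]
  calc δ ^ (-(ξ / b)) * u ^ (ξ / b)
      ≤ δ ^ (-(ξ / b)) * (Real.exp u + k.factorial * Real.exp u) := by gcongr; linarith
    _ ≤ _ := by nlinarith

/-- Telescoping on symmetric intervals: each square is compared with the product of two consecutive
factors, whose inverse is a difference divided by `ε`. -/
theorem sum_inv_one_add_sq_le {ε : ℝ} (hε : 0 < ε) (S : Finset ℤ) :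
    ∑ n ∈ S, ((1 + ε * |(n : ℝ)|) ^ 2)⁻¹ ≤ 1 + 2 / ε := by
  have key (N : ℕ) : ∑ n ∈ Finset.Icc (-(N : ℤ)) N, ((1 + ε * |(n : ℝ)|) ^ 2)⁻¹ ≤
      1 + 2 / ε * (1 - (1 + ε * N)⁻¹) := by
    induction N with
    | zero => simp
    | succ N ih =>
      have hI : Finset.Icc (-((N + 1 : ℕ) : ℤ)) (N + 1 : ℕ) =
          insert ((N : ℤ) + 1) (insert (-((N : ℤ) + 1)) (Finset.Icc (-(N : ℤ)) N)) := by
        ext n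
        simp only [Finset.mem_Icc, Finset.mem_insert]
        omega
      rw [hI, Finset.sum_insert, Finset.sum_insert]
      · have h1 : |(((N : ℤ) + 1 : ℤ) : ℝ)| = N + 1 := by
          push_cast; exact abs_of_nonneg (by positivity)
        have h2 : |((-((N : ℤ) + 1) : ℤ) : ℝ)| = N + 1 := by
          push_cast; rw [abs_neg]; exact abs_of_nonneg (by positivity)
        rw [h1, h2]
        have h3 : ((1 + ε * ((N : ℝ) + 1)) ^ 2)⁻¹ ≤
            1 / ε * ((1 + ε * N)⁻¹ - (1 + ε * ((N : ℝ) + 1))⁻¹) := by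
          have hx : 0 < 1 + ε * (N : ℝ) := by positivity
          have hy : 0 < 1 + ε * ((N : ℝ) + 1) := by positivity
          have he : 1 / ε * ((1 + ε * N)⁻¹ - (1 + ε * ((N : ℝ) + 1))⁻¹) =
              ((1 + ε * (N : ℝ)) * (1 + ε * ((N : ℝ) + 1)))⁻¹ := by
            field_simp
            ring
          rw [he]
          apply inv_anti₀ (by positivity)
          nlinarith
        push_cast
        have h4 : 2 / ε = 2 * (1 / ε) := by ring
        rw [h4] at ih ⊢
        linarith
      · simp
      · simp only [Finset.mem_insert, Finset.mem_Icc]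
        omega
  obtain ⟨N, hN⟩ : ∃ N : ℕ, S ⊆ Finset.Icc (-(N : ℤ)) N := by
    refine ⟨S.sup Int.natAbs, fun n hn => ?_⟩
    have : n.natAbs ≤ S.sup Int.natAbs := Finset.le_sup hn
    rw [Finset.mem_Icc]
    omega
  refine (Finset.sum_le_sum_of_subset_of_nonneg hN fun _ _ _ => by positivity).trans
    ((key N).trans ?_)
  have : 0 ≤ 2 / ε * (1 + ε * (N : ℝ))⁻¹ := by positivity
  linarith

/-- A finite set lies in the box of its coordinate projections, and over a box the sum of products
factors. -/
theorem sum_prod_le_prod {ι α : Type*} [Fintype ι] (w : ι → α → ℝ) (hw : ∀ i x, 0 ≤ w i x)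
    (B : ι → ℝ) (hB : ∀ i (S : Finset α), ∑ x ∈ S, w i x ≤ B i) (S : Finset (ι → α)) :
    ∑ q ∈ S, ∏ i, w i (q i) ≤ ∏ i, B i := by
  classical
  have hS : S ⊆ Fintype.piFinset fun i => S.image (· i) := fun q hq =>
    Fintype.mem_piFinset.2 fun i => Finset.mem_image_of_mem _ hq
  refine (Finset.sum_le_sum_of_subset_of_nonneg hS fun q _ _ =>
    Finset.prod_nonneg fun i _ => hw i _).trans ?_
  rw [← Finset.prod_univ_sum]
  exact Finset.prod_le_prod (fun i _ => Finset.sum_nonneg fun x _ => hw i x) fun i _ => hB i _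

theorem le_prod_of_one_le {ι : Type*} [Fintype ι] {f : ι → ℝ} (hf : ∀ i, 1 ≤ f i) (i : ι) :
    f i ≤ ∏ j, f j := by
  classical
  rw [← Finset.mul_prod_erase _ f (Finset.mem_univ i)]
  refine le_mul_of_one_le_right (by linarith [hf i]) ?_
  exact Finset.prod_induction f (1 ≤ ·) (fun _ _ => one_le_mul_of_one_le_of_one_le) le_rfl
    fun j _ => hf j

theorem one_le_prod_of_one_le {ι : Type*} (s : Finset ι) {f : ι → ℝ} (hf : ∀ i, 1 ≤ f i) :
    1 ≤ ∏ j ∈ s, f j :=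
  Finset.prod_induction f (1 ≤ ·) (fun _ _ => one_le_mul_of_one_le_of_one_le) le_rfl
    fun j _ => hf j

theorem sum_comp_le_sum_of_injective {ι κ : Type*} [Fintype ι] [Fintype κ] {e : ι → κ}
    (he : Function.Injective e) {g : κ → ℝ} (hg : ∀ y, 0 ≤ g y) : ∑ x, g (e x) ≤ ∑ y, g y := by
  refine (Finset.sum_map Finset.univ ⟨e, he⟩ g).symm.trans_le ?_
  exact Finset.sum_le_sum_of_subset_of_nonneg (Finset.subset_univ _) fun y _ _ => hg y

theorem normPow_nonneg {D : ℕ} (ξ : ℝ) (p : Fin D → ℤ) : 0 ≤ normPow ξ p :=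
  Finset.sum_nonneg fun _ _ => by positivity

theorem Xi.val_pos {a b : ℝ} (ha : 0 < a) (hb : 0 < b) (ξ : Xi) : 0 < ξ.val a b := by
  cases ξ <;> simp only [Xi.val] <;> positivity

theorem rescale_rpow {M : ℝ} (hM : 0 < M) (n c : ℝ) {y : ℝ} (hy : 0 ≤ y) :
    (M ^ (-n) * y) ^ (2 * c) = M ^ (-(2 * c * n)) * y ^ (2 * c) := by
  rw [Real.mul_rpow (by positivity) hy, ← Real.rpow_mul hM.le]
  congr 2
  ring

/-- A power of the momentum costs the corresponding power of the scale, and an arbitrarily small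
fraction of the exponential decay. -/
theorem normPow_le_mul_exp (D : ℕ) {ξ b δ : ℝ} (hξ : 0 < ξ) (hb : 0 < b) (hδ : 0 < δ) :
    ∃ C : ℝ, 1 ≤ C ∧ ∀ M : ℝ, 0 < M → ∀ (n : ℝ) (q : Fin D → ℤ),
      normPow ξ q ≤ C * M ^ (2 * ξ * n) *
        Real.exp (δ * (M ^ (-(2 * b * n)) * normPow b q)) := by
  obtain ⟨C, hC1, hC⟩ := rpow_le_mul_exp_rpow hξ hb hδ
  -- The summand 1 keeps the constant at least 1 when `D = 0`.
  refine ⟨1 + D * C, by have : 0 ≤ D * C := by positivity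
                        linarith, fun M hM n q => ?_⟩
  have hterm (i : Fin D) : |(q i : ℝ)| ^ (2 * ξ) ≤ C * M ^ (2 * ξ * n) *
        Real.exp (δ * (M ^ (-(2 * b * n)) * normPow b q)) := by
    have h1 := hC (M ^ (-n) * |(q i : ℝ)|) (by positivity)
    rw [rescale_rpow hM _ _ (abs_nonneg _), rescale_rpow hM _ _ (abs_nonneg _),
      Real.rpow_neg hM.le, inv_mul_le_iff₀ (by positivity)] at h1
    refine h1.trans ?_
    have h2 : |(q i : ℝ)| ^ (2 * b) ≤ normPow b q :=
      Finset.single_le_sum (f := fun i => |(q i : ℝ)| ^ (2 * b)) (fun _ _ => by positivity)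
        (Finset.mem_univ i)
    calc _ ≤ M ^ (2 * ξ * n) * (C * Real.exp (δ * (M ^ (-(2 * b * n)) * normPow b q))) := by
          gcongr
      _ = _ := by ring
  calc normPow ξ q ≤ ∑ _i : Fin D, C * M ^ (2 * ξ * n) *
        Real.exp (δ * (M ^ (-(2 * b * n)) * normPow b q)) :=
      Finset.sum_le_sum fun i _ => hterm i
    _ = (D * C) * (M ^ (2 * ξ * n) *
        Real.exp (δ * (M ^ (-(2 * b * n)) * normPow b q))) := by simp; ring
    _ ≤ (1 + D * C) * (M ^ (2 * ξ * n) *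
        Real.exp (δ * (M ^ (-(2 * b * n)) * normPow b q))) := by gcongr; linarith
    _ = _ := by ring

/-- The sum over the momentum of a face at scale `n`. -/
theorem sum_exp_normPow_le (D : ℕ) {b : ℝ} (hb : 0 < b) :
    ∃ C : ℝ, 1 ≤ C ∧ ∀ M : ℝ, 1 < M → ∀ n : ℝ, 0 ≤ n → ∀ S : Finset (Fin D → ℤ),
      ∑ q ∈ S, Real.exp (-(1 / 2 * (M ^ (-(2 * b * n)) * normPow b q))) ≤ C * M ^ (D * n) := by
  obtain ⟨C, hC1, hC⟩ := rpow_le_mul_exp_rpow one_pos hb (δ := 1 / 2) (by norm_num)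
  have hA : 1 ≤ (2 + 2 * C) * 3 := by linarith
  refine ⟨((2 + 2 * C) * 3) ^ D, one_le_pow₀ hA, fun M hM n hn S => ?_⟩
  have hM0 : 0 < M := by linarith
  set ε := M ^ (-n) with hε
  have hε0 : 0 < ε := Real.rpow_pos_of_pos hM0 _
  have hε1 : ε ≤ 1 := Real.rpow_le_one_of_one_le_of_nonpos hM.le (by linarith)
  -- With `x = ε |k|`, `(1 + x) ^ 2 ≤ 2 + 2 x ^ 2`, and `x ^ 2` is at most `C` times the inverse of
  -- the left side. The resulting inverse squares sum to `O(1 / ε) = O(M ^ n)`.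
  have hpt (k : ℤ) : Real.exp (-(1 / 2 * (M ^ (-(2 * b * n)) * |(k : ℝ)| ^ (2 * b)))) ≤
      (2 + 2 * C) * ((1 + ε * |(k : ℝ)|) ^ 2)⁻¹ := by
    have h1 := hC (ε * |(k : ℝ)|) (by positivity)
    rw [mul_one, Real.rpow_two, rescale_rpow hM0 _ _ (abs_nonneg _)] at h1
    rw [Real.exp_neg, ← div_eq_mul_inv, inv_le_comm₀ (by positivity) (by positivity), inv_div,
      div_le_iff₀ (by positivity)]
    have h2 : 1 ≤ Real.exp (1 / 2 * (M ^ (-(2 * b * n)) * |(k : ℝ)| ^ (2 * b))) :=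
      Real.one_le_exp (by positivity)
    nlinarith [sq_nonneg (1 - ε * |(k : ℝ)|)]
  have hone (S : Finset ℤ) :
      ∑ k ∈ S, Real.exp (-(1 / 2 * (M ^ (-(2 * b * n)) * |(k : ℝ)| ^ (2 * b)))) ≤
        (2 + 2 * C) * 3 * M ^ n := by
    calc _ ≤ ∑ k ∈ S, (2 + 2 * C) * ((1 + ε * |(k : ℝ)|) ^ 2)⁻¹ :=
          Finset.sum_le_sum fun k _ => hpt k
      _ ≤ (2 + 2 * C) * (1 + 2 / ε) := by
          rw [← Finset.mul_sum]
          gcongr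
          exact sum_inv_one_add_sq_le hε0 S
      _ ≤ (2 + 2 * C) * (3 * ε⁻¹) := by
          gcongr
          have := (one_le_inv₀ hε0).2 hε1
          rw [div_eq_mul_inv]
          linarith
      _ = _ := by rw [hε, Real.rpow_neg hM0.le, inv_inv]; ring
  have h := sum_prod_le_prod (ι := Fin D)
    (fun _ (k : ℤ) => Real.exp (-(1 / 2 * (M ^ (-(2 * b * n)) * |(k : ℝ)| ^ (2 * b)))))
    (fun _ _ => (Real.exp_pos _).le) (fun _ => (2 + 2 * C) * 3 * M ^ n) (fun _ => hone) S
  rw [Finset.prod_const, Finset.card_univ, Fintype.card_fin, mul_pow, ← Real.rpow_mul_natCast hM0.le,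
    mul_comm n] at h
  refine le_trans (le_of_eq (Finset.sum_congr rfl fun q _ => ?_)) h
  rw [← Real.exp_sum, normPow, Finset.sum_neg_distrib, Finset.mul_sum, Finset.mul_sum]

/-! ### The sliced propagator -/

theorem slice_nonneg {M : ℝ} (hM : 1 < M) (E : ℝ) (i : ℕ) : 0 ≤ slice M E i := by
  cases i with
  | zero => exact MeasureTheory.integral_nonneg fun _ => (Real.exp_pos _).le
  | succ i =>
    exact intervalIntegral.integral_nonneg
      (zpow_le_zpow_right₀ hM.le (by omega)) fun _ _ => (Real.exp_pos _).le

/-- Let `t` be the lower endpoint of the slice. For `i ≥ 1` the integrand is at most `exp (-(t *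
E))` on an interval shorter than `M ^ (2 * b) * t`. For `i = 0` the integral is `exp (-(t * E)) / E`
with `1 / E ≤ 1 / mass`, and `M ^ (2 * b) * t = 1`. The factor `1 + mass⁻¹` serves both cases. -/
theorem slice_le {M b mass E : ℝ} (hM : 1 < M) (hb : 0 < b) (hmass : 0 < mass) (hE : mass ≤ E)
    (i : ℕ) :
    slice (M ^ b) E i ≤ (M ^ (2 * b) * (1 + mass⁻¹)) * M ^ (-(2 * b * ((i : ℝ) + 1))) *
      Real.exp (-(M ^ (-(2 * b * ((i : ℝ) + 1))) * E)) := by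
  have hM0 : 0 < M := by linarith
  have hE0 : 0 < E := by linarith
  have hz (z : ℤ) : (M ^ b) ^ z = M ^ (b * z) := by
    rw [← Real.rpow_intCast, ← Real.rpow_mul hM0.le]
  cases i with
  | zero =>
    have h0 : slice (M ^ b) E 0 =
        Real.exp (-(M ^ (-(2 * b * ((0 : ℕ) + 1 : ℝ))) * E)) * E⁻¹ := by
      have h := integral_exp_mul_Ioi (a := -E) (by linarith) ((M ^ b) ^ (-2 : ℤ))
      have h' : slice (M ^ b) E 0 =
          ∫ x in Set.Ioi ((M ^ b) ^ (-2 : ℤ)), Real.exp (-E * x) := by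
        simp only [slice]
        congr 1 with x
        ring_nf
      rw [h', h, hz]
      have : b * ((-2 : ℤ) : ℝ) = -(2 * b * ((0 : ℕ) + 1 : ℝ)) := by push_cast; ring
      rw [this, neg_mul, mul_comm E, neg_div_neg_eq, div_eq_mul_inv]
    rw [h0, mul_comm]
    refine mul_le_mul_of_nonneg_right ?_ (Real.exp_pos _).le
    have h1 : M ^ (2 * b) * (1 + mass⁻¹) * M ^ (-(2 * b * ((0 : ℕ) + 1 : ℝ))) = 1 + mass⁻¹ := by
      rw [mul_right_comm, ← Real.rpow_add hM0]
      simp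
    rw [h1]
    have := inv_anti₀ hmass hE
    linarith
  | succ i =>
    have hlow : (M ^ b) ^ (-2 * ((i : ℤ) + 2)) = M ^ (-(2 * b * (((i + 1 : ℕ) : ℝ) + 1))) := by
      rw [hz]; congr 1; push_cast; ring
    have hup : (M ^ b) ^ (-2 * ((i : ℤ) + 1)) =
        M ^ (2 * b) * M ^ (-(2 * b * (((i + 1 : ℕ) : ℝ) + 1))) := by
      rw [hz, ← Real.rpow_add hM0]; congr 1; push_cast; ring
    simp only [slice]
    rw [hlow, hup]
    set t := M ^ (-(2 * b * (((i + 1 : ℕ) : ℝ) + 1))) with ht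
    have ht0 : 0 < t := Real.rpow_pos_of_pos hM0 _
    have hA : 1 ≤ M ^ (2 * b) := Real.one_le_rpow hM.le (by linarith)
    have hle : t ≤ M ^ (2 * b) * t := le_mul_of_one_le_left ht0.le hA
    have h := intervalIntegral.norm_integral_le_of_norm_le_const (a := t) (b := M ^ (2 * b) * t)
      (f := fun α => Real.exp (-(α * E))) (C := Real.exp (-(t * E))) (fun x hx => by
        rw [Set.uIoc_of_le hle] at hx
        rw [Real.norm_of_nonneg (Real.exp_pos _).le]
        gcongr
        exact hx.1.le)
    refine (Real.le_norm_self _).trans (h.trans ?_)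
    rw [abs_of_nonneg (by linarith), mul_comm]
    gcongr
    have : 0 ≤ M ^ (2 * b) * t * mass⁻¹ := by positivity
    nlinarith

theorem mass_add_le_kinetic (m : Model) {d D : ℕ} (a b mass : ℝ) (P : Mom d D) :
    mass + ∑ s, normPow b (P s) ≤ kinetic m a b mass P := by
  have hb : Xi.b ∈ m.exponents := by cases m <;> simp [Model.exponents]
  have := Finset.single_le_sum (f := fun ξ : Xi => ∑ s, normPow (ξ.val a b) (P s))
    (fun ξ _ => Finset.sum_nonneg fun s _ => normPow_nonneg _ _) hb
  have hval : Xi.b.val a b = b := rfl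
  beta_reduce at this
  rw [hval] at this
  rw [kinetic]
  linarith

theorem slice_kinetic_le (m : Model) {d D : ℕ} {a b mass M : ℝ} (hM : 1 < M) (hb : 0 < b)
    (hmass : 0 < mass) (P : Mom d D) (i : ℕ) :
    slice (M ^ b) (kinetic m a b mass P) i ≤
      (M ^ (2 * b) * (1 + mass⁻¹)) * M ^ (-(2 * b * ((i : ℝ) + 1))) *
        ∏ s, Real.exp (-(M ^ (-(2 * b * ((i : ℝ) + 1))) * normPow b (P s))) := by
  have hk := mass_add_le_kinetic m a b mass P
  have h0 : 0 ≤ ∑ s, normPow b (P s) := Finset.sum_nonneg fun s _ => normPow_nonneg _ _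
  have hM0 : 0 < M := by linarith
  refine (slice_le hM hb hmass (by linarith) i).trans ?_
  rw [← Real.exp_sum, Finset.sum_neg_distrib, ← Finset.mul_sum]
  gcongr
  linarith

end EnhancedTensor
end

noncomputable section
namespace EnhancedTensor
namespace FeynmanGraph

variable {m : Model} {d : ℕ} (G : FeynmanGraph m d)

/-! ### Faces -/

theorem bicolored_adj_line {T : Set G.L} (s : Fin d) {l : G.L} (hl : l ∈ T) :
    (G.bicolored T s).Adj (.inl (G.src l)) (.inr (G.tgt l)) := by
  rw [bicolored, SimpleGraph.fromRel_adj]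
  exact ⟨by simp, .inl (.inl ⟨l, hl, rfl, rfl⟩)⟩

theorem bicolored_adj_strand (T : Set G.L) (s : Fin d) (c : G.Corner) :
    (G.bicolored T s).Adj (.inl c) (.inr ⟨c.1, (G.kind c.1).strand s c.2⟩) := by
  rw [bicolored, SimpleGraph.fromRel_adj]
  exact ⟨by simp, .inl (.inr ⟨c, rfl, rfl⟩)⟩

/-- An equivalence relation that holds along the lines and the strands, holds
on the connected components of the bicolored graph. -/
theorem bicolored_reachable_induction {T : Set G.L} {s : Fin d} {r : G.Field → G.Field → Prop}
    (hr : Equivalence r) (hline : ∀ l ∈ T, r (.inl (G.src l)) (.inr (G.tgt l)))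
    (hstrand : ∀ c : G.Corner, r (.inl c) (.inr ⟨c.1, (G.kind c.1).strand s c.2⟩))
    {x y : G.Field} (h : (G.bicolored T s).Reachable x y) : r x y := by
  obtain ⟨w⟩ := h
  induction w with
  | nil => exact hr.refl _
  | cons hadj _ ih =>
    refine hr.trans ?_ ih
    rw [bicolored, SimpleGraph.fromRel_adj] at hadj
    rcases hadj.2 with (⟨l, hl, rfl, rfl⟩ | ⟨c, rfl, rfl⟩) | (⟨l, hl, rfl, rfl⟩ | ⟨c, rfl, rfl⟩)
    · exact hline l hl
    · exact hstrand c
    · exact hr.symm (hline l hl)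
    · exact hr.symm (hstrand c)

variable {G}

/-- The field `x` lies on the face `f` of color `s`. -/
def IntFace.Mem {T : Set G.L} (f : G.IntFace T) (s : Fin d) (x : G.Field) : Prop :=
  f.1 = s ∧ x ∈ f.2.1.supp

theorem IntFace.eq_of_mem {T : Set G.L} {f f' : G.IntFace T} {s : Fin d} {x : G.Field}
    (h : f.Mem s x) (h' : f'.Mem s x) : f = f' := by
  obtain ⟨s₁, c, hc⟩ := f
  obtain ⟨s₂, c', hc'⟩ := f'
  obtain ⟨h1, h2⟩ := h
  obtain ⟨h1', h2'⟩ := h'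
  dsimp only at h1 h1'
  subst h1
  subst h1'
  have : c = c' := h2.symm.trans h2'
  subst this
  rfl

theorem IntFace.exists_mem {T : Set G.L} (f : G.IntFace T) : ∃ x, f.Mem f.1 x := by
  obtain ⟨x, hx⟩ := f.2.1.nonempty_supp
  exact ⟨x, rfl, hx⟩

theorem IntFace.mem_iff_of_reachable {T : Set G.L} {f : G.IntFace T} {x y : G.Field}
    (h : (G.bicolored T f.1).Reachable x y) : x ∈ f.2.1.supp ↔ y ∈ f.2.1.supp := by
  rw [SimpleGraph.ConnectedComponent.mem_supp_iff, SimpleGraph.ConnectedComponent.mem_supp_iff,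
    SimpleGraph.ConnectedComponent.eq.2 h]

theorem IntFace.exists_line {T : Set G.L} (f : G.IntFace T) :
    ∃ l ∈ T, .inl (G.src l) ∈ f.2.1.supp := by
  obtain ⟨x, -, hx⟩ := f.exists_mem
  have h := f.2.2 x hx
  rcases x with c | c
  · obtain ⟨l, hl, rfl⟩ := h
    exact ⟨l, hl, hx⟩
  · obtain ⟨l, hl, rfl⟩ := h
    exact ⟨l, hl, (mem_iff_of_reachable (G.bicolored_adj_line f.1 hl).reachable).2 hx⟩

/-- The line of lowest scale of an internal face. -/
theorem IntFace.exists_lowest_line {T : Set G.L} (f : G.IntFace T) (scale : G.L → ℕ) :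
    ∃ l ∈ T, .inl (G.src l) ∈ f.2.1.supp ∧
      ∀ l' ∈ T, .inl (G.src l') ∈ f.2.1.supp → scale l ≤ scale l' := by
  classical
  obtain ⟨l₀, hl₀⟩ := f.exists_line
  obtain ⟨l, hl, hmin⟩ := Finset.exists_min_image
    (Finset.univ.filter fun l => l ∈ T ∧ .inl (G.src l) ∈ f.2.1.supp) scale
    ⟨l₀, by simpa using hl₀⟩
  simp only [Finset.mem_filter, Finset.mem_univ, true_and] at hl hmin
  exact ⟨l, hl.1, hl.2, fun l' h h' => hmin l' ⟨h, h'⟩⟩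

/-- This is the dichotomy between summed and prescribed momenta: a component that is not an internal
face contains a field on no line. -/
theorem exists_intFace_or_open (s : Fin d) (x : G.Field) :
    (∃ f : G.IntFace Set.univ, f.Mem s x) ∨
      ∃ y : G.ExtLeg, (G.bicolored Set.univ s).Reachable x y.1 := by
  by_cases h : ∀ y ∈ ((G.bicolored Set.univ s).connectedComponentMk x).supp, G.OnLine Set.univ y
  · exact .inl ⟨⟨s, _, h⟩, rfl, rfl⟩
  · push Not at h
    obtain ⟨y, hy, hl⟩ := h
    exact .inr ⟨⟨y, hl⟩, SimpleGraph.ConnectedComponent.eq.1 hy.symm⟩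

/-- A face of the graph all of whose lines belong to `T` is a connected component of the bicolored
graph of `T`. -/
theorem IntFace.supp_connectedComponentMk {T : Set G.L} (f : G.IntFace Set.univ)
    (hf : ∀ l, .inl (G.src l) ∈ f.2.1.supp → l ∈ T) {x : G.Field} (hx : x ∈ f.2.1.supp) :
    ((G.bicolored T f.1).connectedComponentMk x).supp = f.2.1.supp := by
  ext y
  constructor
  · intro hy
    refine (mem_iff_of_reachable ?_).1 hx
    refine G.bicolored_reachable_induction (T := T) (s := f.1)
      (r := (G.bicolored Set.univ f.1).Reachable)
      ⟨fun _ => .rfl, fun h => h.symm, fun h h' => h.trans h'⟩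
      (fun l _ => (G.bicolored_adj_line _ (Set.mem_univ l)).reachable)
      (fun c => (G.bicolored_adj_strand _ _ c).reachable) ?_
    exact SimpleGraph.ConnectedComponent.eq.1 (Eq.symm hy)
  · intro hy
    have hxy : (G.bicolored Set.univ f.1).Reachable x y :=
      SimpleGraph.ConnectedComponent.eq.1 (hx.trans hy.symm)
    -- Membership in the face is carried along with reachability, since a line is known to be in `T`
    -- only if it is on the face.
    have key := G.bicolored_reachable_induction (T := Set.univ) (s := f.1)
      (r := fun x y => (x ∈ f.2.1.supp ↔ y ∈ f.2.1.supp) ∧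
        (x ∈ f.2.1.supp → (G.bicolored T f.1).Reachable x y))
      ⟨fun _ => ⟨.rfl, fun _ => .rfl⟩, fun h => ⟨h.1.symm, fun hy => (h.2 (h.1.2 hy)).symm⟩,
        fun h h' => ⟨h.1.trans h'.1, fun hx => (h.2 hx).trans (h'.2 (h.1.1 hx))⟩⟩
      (fun l hl => ⟨mem_iff_of_reachable (G.bicolored_adj_line _ hl).reachable,
        fun h => (G.bicolored_adj_line _ (hf l h)).reachable⟩)
      (fun c => ⟨mem_iff_of_reachable (G.bicolored_adj_strand _ _ c).reachable,
        fun _ => (G.bicolored_adj_strand _ _ c).reachable⟩) hxy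
    exact SimpleGraph.ConnectedComponent.eq.2 (key.2 hx).symm

theorem IntFace.exists_restrict {T : Set G.L} (f : G.IntFace Set.univ)
    (hf : ∀ l, .inl (G.src l) ∈ f.2.1.supp → l ∈ T) :
    ∃ f' : G.IntFace T, f'.1 = f.1 ∧ f'.2.1.supp = f.2.1.supp := by
  obtain ⟨x, -, hx⟩ := f.exists_mem
  have hs := f.supp_connectedComponentMk hf hx
  refine ⟨⟨f.1, (G.bicolored T f.1).connectedComponentMk x, fun y hy => ?_⟩, rfl, hs⟩
  rw [hs] at hy
  have h := f.2.2 y hy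
  rcases y with c | c
  · obtain ⟨l, -, rfl⟩ := h
    exact ⟨l, hf l hy, rfl⟩
  · obtain ⟨l, hl, rfl⟩ := h
    exact ⟨l, hf l ((mem_iff_of_reachable (G.bicolored_adj_line f.1 hl).reachable).2 hy), rfl⟩

/-- The vertex of a field. -/
def Field.vertex : G.Field → G.V
  | .inl c => c.1
  | .inr c => c.1

/-- A strand stays inside its vertex, so only lines change the vertex. Hence a face cannot leave a
component of the line graph. -/
theorem lineGraph_reachable_of_bicolored {T : Set G.L} {s : Fin d} {x y : G.Field}
    (h : (G.bicolored T s).Reachable x y) :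
    (G.lineGraph T).Reachable (Field.vertex x) (Field.vertex y) := by
  refine G.bicolored_reachable_induction
    (r := fun x y => (G.lineGraph T).Reachable (Field.vertex x) (Field.vertex y))
    ⟨fun _ => .rfl, fun h => h.symm, fun h h' => h.trans h'⟩ (fun l hl => ?_)
    (fun c => .rfl) h
  -- A line from a vertex to itself gives no edge of the simple graph, but also does not move the
  -- vertex.
  by_cases hv : (G.src l).1 = (G.tgt l).1
  · simp only [Field.vertex]
    rw [hv]
  · refine SimpleGraph.Adj.reachable ?_
    rw [lineGraph, SimpleGraph.fromRel_adj]
    exact ⟨hv, .inl ⟨l, hl, rfl, rfl⟩⟩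

/-- A face all of whose lines have scale at least `i` is a face of one of the quasi-local
subgraphs of scale `i`. -/
theorem IntFace.exists_component {scale : G.L → ℕ} {i : ℕ} (f : G.IntFace Set.univ)
    (hf : ∀ l, .inl (G.src l) ∈ f.2.1.supp → i ≤ scale l) :
    ∃ (k : G.Component scale i) (f' : G.IntFace (G.componentLines scale i k)),
      f'.1 = f.1 ∧ f'.2.1.supp = f.2.1.supp := by
  obtain ⟨x, -, hx⟩ := f.exists_mem
  have hs := f.supp_connectedComponentMk (T := G.highLines scale i) hf hx
  refine ⟨(G.lineGraph (G.highLines scale i)).connectedComponentMk (Field.vertex x),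
    f.exists_restrict fun l hl => ⟨hf l hl, ?_⟩⟩
  rw [← hs] at hl
  exact SimpleGraph.ConnectedComponent.eq.2
    (lineGraph_reachable_of_bicolored (SimpleGraph.ConnectedComponent.eq.1 hl))

/-! ### The degree -/

open Classical in
/-- The power of the momentum of color `s` of a corner in the weight of its vertex. -/
def cornerExp (a b : ℝ) (s : Fin d) (c : G.Corner) : ℝ :=
  (if (G.kind c.1).IsEnhancedStrand s c.2 then 2 * a else 0) +
    ∑ ξ ∈ m.exponents, if (G.kind c.1).IsTwo ξ s then 2 * ξ.val a b else 0

open Classical in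
/-- The power of the momentum that flows in an internal face. -/
def faceExp (a b : ℝ) {T : Set G.L} (f : G.IntFace T) : ℝ :=
  ∑ c : G.Corner, if .inl c ∈ f.2.1.supp then cornerExp a b f.1 c else 0

theorem cornerExp_nonneg {a b : ℝ} (ha : 0 < a) (hb : 0 < b) (s : Fin d) (c : G.Corner) :
    0 ≤ cornerExp a b s c := by
  refine add_nonneg ?_ (Finset.sum_nonneg fun ξ _ => ?_)
  · split_ifs <;> linarith
  · have := Xi.val_pos ha hb ξ
    split_ifs <;> linarith

theorem faceExp_nonneg {a b : ℝ} (ha : 0 < a) (hb : 0 < b) {T : Set G.L} (f : G.IntFace T) :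
    0 ≤ faceExp a b f := by
  refine Finset.sum_nonneg fun c _ => ?_
  have := cornerExp_nonneg ha hb f.1 c
  split_ifs <;> linarith

theorem sum_ite_ite_eq_card {ι : Type*} [Fintype ι] (p q : ι → Prop) [DecidablePred p]
    [DecidablePred q] (x : ℝ) :
    (∑ i, if q i then (if p i then x else 0) else 0) = x * (Nat.card {i // p i ∧ q i} : ℝ) := by
  have h (i : ι) : (if q i then (if p i then x else 0) else 0) = if p i ∧ q i then x else 0 := by
    by_cases hp : p i <;> by_cases hq : q i <;> simp [hp, hq]
  rw [Finset.sum_congr rfl fun i _ => h i, Nat.card_eq_fintype_card, Fintype.card_subtype,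
    Finset.sum_ite, Finset.sum_const_zero, add_zero, Finset.sum_const, nsmul_eq_mul, mul_comm]

theorem faceExp_eq (a b : ℝ) {T : Set G.L} (f : G.IntFace T) :
    faceExp a b f = 2 * a * G.rhoFace f +
      ∑ ξ ∈ m.exponents, 2 * ξ.val a b * G.rhoTwoFace ξ f := by
  classical
  have h (c : G.Corner) : (if .inl c ∈ f.2.1.supp then cornerExp a b f.1 c else 0) =
      (if .inl c ∈ f.2.1.supp then
        (if (G.kind c.1).IsEnhancedStrand f.1 c.2 then 2 * a else 0) else 0) +
      ∑ ξ ∈ m.exponents, if .inl c ∈ f.2.1.supp then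
        (if (G.kind c.1).IsTwo ξ f.1 then 2 * ξ.val a b else 0) else 0 := by
    unfold cornerExp
    split_ifs <;> simp
  unfold faceExp
  rw [Finset.sum_congr rfl fun c _ => h c, Finset.sum_add_distrib, Finset.sum_comm]
  simp only [sum_ite_ite_eq_card]
  rfl

/-- Distributing the `ρ` terms over the faces gives each face the weight that it has in the bound on
the amplitude. -/
theorem degree_eq (D : ℕ) (a b : ℝ) (T : Set G.L) :
    G.degree D a b T = -2 * b * (Nat.card T : ℝ) + ∑ f : G.IntFace T, (D + faceExp a b f) := by
  simp only [faceExp_eq, degree, rho, rhoTwo, Finset.sum_add_distrib, Nat.cast_sum,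
    Finset.sum_const, Finset.card_univ, nsmul_eq_mul, Nat.card_eq_fintype_card, ← Finset.mul_sum]
  rw [Finset.sum_comm]
  simp only [← Finset.mul_sum]
  ring

theorem sum_card_componentLines_le (scale : G.L → ℕ) (i : ℕ) :
    ∑ k : G.Component scale i, (Nat.card (G.componentLines scale i k) : ℝ) ≤
      Nat.card (G.highLines scale i) := by
  rw [← Nat.cast_sum, ← Nat.card_sigma]
  norm_cast
  refine Nat.card_le_card_of_injective
    (fun x : Σ k : G.Component scale i, G.componentLines scale i k =>
      (⟨x.2.1, x.2.2.1⟩ : G.highLines scale i)) ?_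
  rintro ⟨k, l, hl⟩ ⟨k', l', hl'⟩ h
  have hll : l = l' := congrArg Subtype.val h
  subst hll
  have hk : k = k' := hl.2.symm.trans hl'.2
  subst hk
  rfl

/-- A line lies in `G^i` for `i = 0, …, scale l`. This count is the `n = i + 1` of the propagator
bound. -/
theorem sum_card_highLines_le (scale : G.L → ℕ) (Λ : ℕ) :
    ∑ i ∈ Finset.range (Λ + 1), (Nat.card (G.highLines scale i) : ℝ) ≤
      ∑ l, ((scale l : ℝ) + 1) := by
  classical
  have h (i : ℕ) : (Nat.card (G.highLines scale i) : ℝ) =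
      ∑ l, if i ≤ scale l then (1 : ℝ) else 0 := by
    rw [Finset.sum_boole]
    exact congrArg Nat.cast (Nat.subtype_card _ (by simp [highLines]))
  simp only [h]
  rw [Finset.sum_comm]
  refine Finset.sum_le_sum fun l _ => ?_
  rw [Finset.sum_boole]
  norm_cast
  calc _ ≤ (Finset.range (scale l + 1)).card := Finset.card_le_card fun i hi => by
        simp only [Finset.mem_filter, Finset.mem_range] at hi ⊢
        omega
    _ = _ := Finset.card_range _

/-- The sum over the faces of the scale of the lowest line is the sum over the quasi-local
subgraphs of their internal faces. -/
theorem sum_faces_le {D : ℕ} {a b : ℝ} (ha : 0 < a) (hb : 0 < b) (scale : G.L → ℕ) {Λ : ℕ}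
    (hΛ : ∀ l, scale l ≤ Λ) (low : G.IntFace Set.univ → G.L)
    (hlow : ∀ f l, .inl (G.src l) ∈ f.2.1.supp → scale (low f) ≤ scale l) :
    ∑ f, ((scale (low f) : ℝ) + 1) * (D + faceExp a b f) ≤
      ∑ i ∈ Finset.range (Λ + 1), ∑ k : G.Component scale i,
        ∑ f : G.IntFace (G.componentLines scale i k), (D + faceExp a b f) := by
  classical
  have hcount (f : G.IntFace Set.univ) : ((scale (low f) : ℝ) + 1) * (D + faceExp a b f) =
      ∑ i ∈ Finset.range (Λ + 1), if i ≤ scale (low f) then D + faceExp a b f else 0 := by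
    rw [← Finset.sum_filter, Finset.sum_const, nsmul_eq_mul]
    congr 1
    have : (Finset.range (Λ + 1)).filter (· ≤ scale (low f)) =
        Finset.range (scale (low f) + 1) := by
      ext i
      simp only [Finset.mem_filter, Finset.mem_range]
      have := hΛ (low f)
      omega
    rw [this, Finset.card_range]
    norm_cast
  rw [Finset.sum_congr rfl fun f _ => hcount f, Finset.sum_comm]
  refine Finset.sum_le_sum fun i _ => ?_
  rw [← Finset.sum_filter, ← Fintype.sum_sigma' (fun (k : G.Component scale i)
    (f : G.IntFace (G.componentLines scale i k)) => (D : ℝ) + faceExp a b f)]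
  have hex (f : {f : G.IntFace Set.univ // i ≤ scale (low f)}) :
      ∃ f' : Σ k : G.Component scale i, G.IntFace (G.componentLines scale i k),
        f'.2.1 = f.1.1 ∧ f'.2.2.1.supp = f.1.2.1.supp := by
    obtain ⟨k, f', h⟩ := f.1.exists_component fun l hl => f.2.trans (hlow _ l hl)
    exact ⟨⟨k, f'⟩, h⟩
  choose e he1 he2 using hex
  have hinj : Function.Injective e := by
    intro f g hfg
    obtain ⟨x, -, hx⟩ := f.1.exists_mem
    refine Subtype.ext (IntFace.eq_of_mem ⟨rfl, hx⟩ ⟨?_, ?_⟩)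
    · rw [← he1, ← he1, hfg]
    · rwa [← he2, ← hfg, he2]
  have hW (f : {f : G.IntFace Set.univ // i ≤ scale (low f)}) :
      (D : ℝ) + faceExp a b f.1 = D + faceExp a b (e f).2 := by
    simp only [faceExp, he1, he2]
  rw [Finset.sum_subtype (p := fun f => i ≤ scale (low f)) _ (by simp),
    Finset.sum_congr rfl fun f _ => hW f]
  -- A component may have further internal faces; they only add nonnegative terms.
  refine sum_comp_le_sum_of_injective hinj
    (g := fun f => (D : ℝ) + faceExp a b f.2) (fun f => ?_)
  have := faceExp_nonneg ha hb f.2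
  positivity

theorem sum_degree_ge {D : ℕ} {a b : ℝ} (ha : 0 < a) (hb : 0 < b) (scale : G.L → ℕ) {Λ : ℕ}
    (hΛ : ∀ l, scale l ≤ Λ) (low : G.IntFace Set.univ → G.L)
    (hlow : ∀ f l, .inl (G.src l) ∈ f.2.1.supp → scale (low f) ≤ scale l) :
    -(∑ l, 2 * b * ((scale l : ℝ) + 1)) +
        ∑ f, ((scale (low f) : ℝ) + 1) * (D + faceExp a b f) ≤
      ∑ i ∈ Finset.range (Λ + 1), ∑ k : G.Component scale i,
        G.degree D a b (G.componentLines scale i k) := by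
  simp only [degree_eq, Finset.sum_add_distrib (f := fun k : G.Component scale _ =>
    -2 * b * (Nat.card (G.componentLines scale _ k) : ℝ))]
  rw [Finset.sum_add_distrib]
  refine add_le_add ?_ (sum_faces_le ha hb scale hΛ low hlow)
  simp only [← Finset.mul_sum]
  have h : ∑ i ∈ Finset.range (Λ + 1), ∑ k : G.Component scale i,
      (Nat.card (G.componentLines scale i k) : ℝ) ≤ ∑ l, ((scale l : ℝ) + 1) :=
    (Finset.sum_le_sum fun i _ => sum_card_componentLines_le scale i).trans
      (sum_card_highLines_le scale Λ)
  -- The line counts enter with the coefficient `-2 * b`, so their upper bound bounds the degrees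
  -- from below.
  nlinarith

end FeynmanGraph
end EnhancedTensor
end

noncomputable section
namespace EnhancedTensor

/-! ### The vertex weights -/

/-- A bound on all couplings. -/
def Couplings.bound (g : Couplings) : ℝ :=
  1 + |g.lam| + |g.eta| + |g.deltaMu| + |g.Z .a| + |g.Z .twoA| + |g.Z .b|

theorem Couplings.bound_pos (g : Couplings) : 0 < g.bound := by
  unfold Couplings.bound
  positivity

theorem Couplings.abs_Z_le_bound (g : Couplings) (ξ : Xi) : |g.Z ξ| ≤ g.bound := by
  have := abs_nonneg g.lam
  have := abs_nonneg g.eta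
  have := abs_nonneg g.deltaMu
  have := abs_nonneg (g.Z .a)
  have := abs_nonneg (g.Z .twoA)
  have := abs_nonneg (g.Z .b)
  unfold Couplings.bound
  cases ξ <;> linarith

/-- The weight of a vertex is bounded by the product over its strands of bounds on the powers of the
momenta that they carry. -/
theorem VertexKind.abs_weight_le {m : Model} {d D : ℕ} (a b : ℝ) (g : Couplings)
    (k : VertexKind m d) (P : Fin k.arity → Mom d D) (Y : Fin d → Fin k.arity → ℝ)
    (hY : ∀ s j, 1 ≤ Y s j)
    (hE : ∀ s j, k.IsEnhancedStrand s j → normPow a (P j s) ≤ Y s j)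
    (hT : ∀ ξ ∈ m.exponents, ∀ s j, k.IsTwo ξ s → normPow (ξ.val a b) (P j s) ≤ Y s j) :
    |k.weight a b g P| ≤ g.bound * ∏ j, ∏ s, Y s j := by
  -- All factors are at least 1, so strands that carry no weight can be included.
  have hprod (j) : 1 ≤ ∏ s, Y s j := one_le_prod_of_one_le _ fun s => hY s j
  have hprod2 : 1 ≤ ∏ j, ∏ s, Y s j := one_le_prod_of_one_le _ hprod
  have hg := g.bound_pos
  have hZ := g.abs_Z_le_bound
  have h1 := abs_nonneg g.lam
  have h2 := abs_nonneg g.eta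
  have h3 := abs_nonneg g.deltaMu
  have h4 := abs_nonneg (g.Z .a)
  have h5 := abs_nonneg (g.Z .twoA)
  have h6 := abs_nonneg (g.Z .b)
  have hlam : |g.lam| ≤ g.bound := by unfold Couplings.bound; linarith
  have heta : |g.eta| ≤ g.bound := by unfold Couplings.bound; linarith
  have hdelta : |g.deltaMu| ≤ g.bound := by unfold Couplings.bound; linarith
  cases k with
  | quartic c =>
    simp only [weight, abs_div, abs_two]
    nlinarith
  | mass =>
    simp only [weight]
    nlinarith
  | two ξ hξ s =>
    have hle : normPow (ξ.val a b) (P (0 : Fin 1) s) ≤ ∏ j, ∏ s, Y s j :=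
      (hT ξ hξ s (0 : Fin 1) ⟨rfl, rfl⟩).trans
        ((le_prod_of_one_le (fun s => hY s (0 : Fin 1)) s).trans
          (le_prod_of_one_le hprod (0 : Fin 1)))
    simp only [weight, abs_mul, abs_of_nonneg (normPow_nonneg _ _)]
    exact mul_le_mul (hZ ξ) hle (normPow_nonneg _ _) hg.le
  | enhanced c =>
    have hsplit : ∏ j, ∏ s, Y s j = (∏ s, Y s (0 : Fin 2)) * ∏ s, Y s (1 : Fin 2) :=
      Fin.prod_univ_two (fun j : Fin 2 => ∏ s, Y s j)
    have hl0 : Y c (0 : Fin 2) ≤ ∏ s, Y s (0 : Fin 2) :=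
      le_prod_of_one_le (fun s => hY s (0 : Fin 2)) c
    have hl1 : Y c (1 : Fin 2) ≤ ∏ s, Y s (1 : Fin 2) :=
      le_prod_of_one_le (fun s => hY s (1 : Fin 2)) c
    have hp0 := hprod (0 : Fin 2)
    have hp1 := hprod (1 : Fin 2)
    have hn0 := normPow_nonneg a (P (0 : Fin 2) c)
    have hn1 := normPow_nonneg a (P (1 : Fin 2) c)
    rw [hsplit]
    set A := ∏ s, Y s (0 : Fin 2)
    set B := ∏ s, Y s (1 : Fin 2)
    -- The factor 2, needed for the symmetrized sum `A + B ≤ 2 * (A * B)`, is absorbed by the half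
    -- in `η / 2`.
    have key {w : ℝ} (hw : 0 ≤ w) (hw2 : w ≤ 2 * (A * B)) :
        |g.eta / 2 * w| ≤ g.bound * (A * B) := by
      rw [abs_mul, abs_div, abs_two, abs_of_nonneg hw]
      calc |g.eta| / 2 * w ≤ g.bound / 2 * (2 * (A * B)) := by gcongr
        _ = _ := by ring
    have hAB : A ≤ A * B := le_mul_of_one_le_right (by linarith) hp1
    have hBA : B ≤ A * B := le_mul_of_one_le_left (by linarith) hp0
    cases m with
    | plus =>
      have e0 : normPow a (P (0 : Fin 2) c) ≤ Y c (0 : Fin 2) := hE c (0 : Fin 2) ⟨rfl, rfl⟩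
      exact key hn0 (by linarith)
    | plusSym =>
      have e0 : normPow a (P (0 : Fin 2) c) ≤ Y c (0 : Fin 2) := hE c (0 : Fin 2) ⟨rfl, trivial⟩
      have e1 : normPow a (P (1 : Fin 2) c) ≤ Y c (1 : Fin 2) := hE c (1 : Fin 2) ⟨rfl, trivial⟩
      exact key (add_nonneg hn0 hn1) (by linarith)
    | times =>
      have e0 : normPow a (P (0 : Fin 2) c) ≤ Y c (0 : Fin 2) := hE c (0 : Fin 2) ⟨rfl, trivial⟩
      have e1 : normPow a (P (1 : Fin 2) c) ≤ Y c (1 : Fin 2) := hE c (1 : Fin 2) ⟨rfl, trivial⟩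
      refine key (mul_nonneg hn0 hn1) ?_
      have : normPow a (P (0 : Fin 2) c) * normPow a (P (1 : Fin 2) c) ≤ A * B :=
        mul_le_mul (e0.trans hl0) (e1.trans hl1) hn1 (by linarith)
      nlinarith

/-- Constants uniform in the exponents, for momenta of internal faces and for bounded momenta. -/
theorem exists_normPow_bound (D : ℕ) {a b δ : ℝ} (ha : 0 < a) (hb : 0 < b) (hδ : 0 < δ) (R : ℝ) :
    ∃ C : ℝ, 1 ≤ C ∧ ∀ ξ : Xi,
      (∀ M : ℝ, 0 < M → ∀ (n : ℝ) (q : Fin D → ℤ), normPow (ξ.val a b) q ≤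
        C * (M ^ (n * (2 * ξ.val a b)) * Real.exp (δ * (M ^ (-(2 * b * n)) * normPow b q)))) ∧
      ∀ q : Fin D → ℤ, (∀ i, |(q i : ℝ)| ≤ R) → normPow (ξ.val a b) q ≤ C := by
  choose C hC1 hC using fun ξ : Xi => normPow_le_mul_exp D (Xi.val_pos ha hb ξ) hb hδ
  have hR (ξ : Xi) : 0 ≤ (D : ℝ) * |R| ^ (2 * ξ.val a b) := by positivity
  set B : Xi → ℝ := fun ξ => C ξ + D * |R| ^ (2 * ξ.val a b) with hB
  have hB1 (ξ : Xi) : 1 ≤ B ξ := by simp only [hB]; linarith [hC1 ξ, hR ξ]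
  have hBle (ξ : Xi) : B ξ ≤ B .a + B .twoA + B .b := by
    have := hB1 .a
    have := hB1 .twoA
    have := hB1 .b
    cases ξ <;> linarith
  refine ⟨B .a + B .twoA + B .b, (hB1 .a).trans (hBle .a),
    fun ξ => ⟨fun M hM n q => ?_, fun q hq => ?_⟩⟩
  · refine (hC ξ M hM n q).trans ?_
    rw [mul_assoc, mul_comm n]
    gcongr
    have := hBle ξ
    simp only [hB] at this ⊢
    linarith [hR ξ]
  · have hle : normPow (ξ.val a b) q ≤ D * |R| ^ (2 * ξ.val a b) := by
      have := Xi.val_pos ha hb ξ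
      calc normPow (ξ.val a b) q ≤ ∑ _i : Fin D, |R| ^ (2 * ξ.val a b) :=
            Finset.sum_le_sum fun i _ => by
              refine Real.rpow_le_rpow (abs_nonneg _) ?_ (by positivity)
              exact (hq i).trans (le_abs_self R)
        _ = _ := by simp
    have := hBle ξ
    simp only [hB] at this ⊢
    linarith [hC1 ξ]

namespace FeynmanGraph

variable {m : Model} {d : ℕ} {G : FeynmanGraph m d}

/-! ### Momentum conservation along the faces -/

/-- The momenta are conserved along the lines and the strands. -/
def Conserved {D : ℕ} (P : G.Field → Mom d D) : Prop :=
  (∀ l, P (.inl (G.src l)) = P (.inr (G.tgt l))) ∧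
    ∀ s (c : G.Corner), P (.inl c) s = P (.inr ⟨c.1, (G.kind c.1).strand s c.2⟩) s

theorem conserved_of_integrand_ne_zero {D : ℕ} {a b mass M : ℝ} {g : Couplings} {scale : G.L → ℕ}
    {P : G.Field → Mom d D} (h : G.integrand a b mass M g scale P ≠ 0) : Conserved P := by
  rw [integrand, mul_ne_zero_iff, Finset.prod_ne_zero_iff, Finset.prod_ne_zero_iff] at h
  refine ⟨fun l => ?_, fun s c => ?_⟩
  · have := h.1 l (Finset.mem_univ l)
    by_contra hne
    exact this (if_neg hne)
  · have := h.2 c.1 (Finset.mem_univ c.1)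
    by_contra hne
    refine this (neg_eq_zero.2 (if_neg fun hall => hne ?_))
    exact hall s c.2

theorem Conserved.eq_of_reachable {D : ℕ} {P : G.Field → Mom d D} (hP : Conserved P) {s : Fin d}
    {x y : G.Field} (h : (G.bicolored Set.univ s).Reachable x y) : P x s = P y s :=
  G.bicolored_reachable_induction (r := fun x y => P x s = P y s)
    ⟨fun _ => rfl, fun h => h.symm, fun h h' => h.trans h'⟩
    (fun l _ => congrFun (hP.1 l) s) (fun c => hP.2 s c) h

theorem Conserved.eq_of_mem {D : ℕ} {P : G.Field → Mom d D} (hP : Conserved P)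
    {f : G.IntFace Set.univ} {s : Fin d} {x y : G.Field} (hx : f.Mem s x)
    (hy : y ∈ f.2.1.supp) : P x s = P y f.1 := by
  obtain ⟨rfl, hx⟩ := hx
  exact hP.eq_of_reachable (SimpleGraph.ConnectedComponent.eq.1 (hx.trans hy.symm))

/-- Conserved momenta are determined by the external momenta and the momenta of the internal
faces. -/
theorem Conserved.config_ext {D : ℕ} {Pext : G.ExtLeg → Mom d D} {P Q : G.Config Pext}
    (hP : Conserved P.1) (hQ : Conserved Q.1) {low : G.IntFace Set.univ → G.L}
    (hlow : ∀ f : G.IntFace Set.univ, Sum.inl (G.src (low f)) ∈ f.2.1.supp)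
    (h : ∀ f, P.1 (.inl (G.src (low f))) f.1 = Q.1 (.inl (G.src (low f))) f.1) : P = Q := by
  refine Subtype.ext (funext fun x => funext fun s => ?_)
  rcases exists_intFace_or_open s x with ⟨f, hf⟩ | ⟨y, hy⟩
  · rw [hP.eq_of_mem hf (hlow f), hQ.eq_of_mem hf (hlow f), h f]
  · rw [hP.eq_of_reachable hy, hQ.eq_of_reachable hy, P.2 y, Q.2 y]

/-! ### Pointwise bounds -/

/-- There is one decay factor for each pair of a line and a color. Those of the pairs `(low f, f.1)`
are kept, and these pairs are distinct because a field and a color determine the face. Any line of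
the face would do here; minimality of its scale matters only in `sum_faces_le`. -/
theorem prod_propagator_le {D : ℕ} {a b mass M : ℝ} (hM : 1 < M) (hb : 0 < b) (hmass : 0 < mass)
    (scale : G.L → ℕ) (P : G.Field → Mom d D) {low : G.IntFace Set.univ → G.L}
    (hlow : ∀ f : G.IntFace Set.univ, Sum.inl (G.src (low f)) ∈ f.2.1.supp) :
    |∏ l, slicedPropagator m a b mass (M ^ b) (scale l) (P (.inl (G.src l)))
        (P (.inr (G.tgt l)))| ≤
      (M ^ (2 * b) * (1 + mass⁻¹)) ^ Fintype.card G.L *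
        (∏ l, M ^ (-(2 * b * ((scale l : ℝ) + 1)))) *
        ∏ f, Real.exp (-(M ^ (-(2 * b * ((scale (low f) : ℝ) + 1))) *
          normPow b (P (.inl (G.src (low f))) f.1))) := by
  have hM0 : 0 < M := by linarith
  have hMb : 1 < M ^ b := Real.one_lt_rpow hM hb
  have hl (l : G.L) : |slicedPropagator m a b mass (M ^ b) (scale l) (P (.inl (G.src l)))
        (P (.inr (G.tgt l)))| ≤ (M ^ (2 * b) * (1 + mass⁻¹)) *
        M ^ (-(2 * b * ((scale l : ℝ) + 1))) * ∏ s, Real.exp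
          (-(M ^ (-(2 * b * ((scale l : ℝ) + 1))) * normPow b (P (.inl (G.src l)) s))) := by
    refine le_trans ?_ (slice_kinetic_le m (a := a) hM hb hmass (P (.inl (G.src l))) (scale l))
    unfold slicedPropagator
    split_ifs
    · rw [abs_of_nonneg (slice_nonneg hMb _ _)]
    · rw [abs_zero]
      exact slice_nonneg hMb _ _
  rw [Finset.abs_prod]
  refine (Finset.prod_le_prod (fun _ _ => abs_nonneg _) fun l _ => hl l).trans ?_
  rw [Finset.prod_mul_distrib, Finset.prod_mul_distrib, Finset.prod_const, Finset.card_univ]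
  gcongr
  rw [← Fintype.prod_prod_type' (fun (l : G.L) (s : Fin d) => Real.exp
    (-(M ^ (-(2 * b * ((scale l : ℝ) + 1))) * normPow b (P (.inl (G.src l)) s)))),
    ← Real.exp_sum, ← Real.exp_sum, Finset.sum_neg_distrib, Finset.sum_neg_distrib]
  gcongr
  refine sum_comp_le_sum_of_injective (e := fun f => (low f, f.1)) (fun f f' hff => ?_)
    (g := fun x : G.L × Fin d => M ^ (-(2 * b * ((scale x.1 : ℝ) + 1))) *
      normPow b (P (.inl (G.src x.1)) x.2))
    fun x => mul_nonneg (by positivity) (normPow_nonneg _ _)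
  rw [Prod.mk.injEq] at hff
  exact IntFace.eq_of_mem ⟨rfl, hlow f⟩ ⟨hff.2.symm, hff.1 ▸ hlow f'⟩

open Classical in
/-- The bound on the powers of the momentum of color `s` of a corner: `n f` and `N f` are the
scale and the size of the momentum of the face `f`. -/
def cornerBound (a b M δ : ℝ) (n N : G.IntFace Set.univ → ℝ) (s : Fin d) (c : G.Corner) : ℝ :=
  ∏ f : G.IntFace Set.univ, if f.Mem s (.inl c) then
    M ^ (n f * cornerExp a b s c) * Real.exp (δ * (M ^ (-(2 * b * n f)) * N f)) else 1

section cornerBound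

variable {a b M δ : ℝ} {n N : G.IntFace Set.univ → ℝ}

theorem one_le_cornerBound_factor (ha : 0 < a) (hb : 0 < b) (hM : 1 < M) (hδ : 0 < δ)
    (hn : ∀ f, 0 ≤ n f) (hN : ∀ f, 0 ≤ N f) (s : Fin d) (c : G.Corner)
    (f : G.IntFace Set.univ) :
    1 ≤ M ^ (n f * cornerExp a b s c) * Real.exp (δ * (M ^ (-(2 * b * n f)) * N f)) := by
  have hM0 : 0 < M := by linarith
  have := cornerExp_nonneg ha hb s c
  have := hn f
  have := hN f
  exact one_le_mul_of_one_le_of_one_le (Real.one_le_rpow hM.le (by positivity))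
    (Real.one_le_exp (by positivity))

theorem one_le_cornerBound (ha : 0 < a) (hb : 0 < b) (hM : 1 < M) (hδ : 0 < δ)
    (hn : ∀ f, 0 ≤ n f) (hN : ∀ f, 0 ≤ N f) (s : Fin d) (c : G.Corner) :
    1 ≤ cornerBound a b M δ n N s c := by
  refine one_le_prod_of_one_le _ fun f => ?_
  split_ifs
  · exact one_le_cornerBound_factor ha hb hM hδ hn hN s c f
  · exact le_rfl

theorem le_cornerBound (ha : 0 < a) (hb : 0 < b) (hM : 1 < M) (hδ : 0 < δ)
    (hn : ∀ f, 0 ≤ n f) (hN : ∀ f, 0 ≤ N f) {s : Fin d} {c : G.Corner}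
    {f : G.IntFace Set.univ} (hf : f.Mem s (.inl c)) :
    M ^ (n f * cornerExp a b s c) * Real.exp (δ * (M ^ (-(2 * b * n f)) * N f)) ≤
      cornerBound a b M δ n N s c := by
  classical
  have h := le_prod_of_one_le (f := fun f : G.IntFace Set.univ => if f.Mem s (.inl c) then
    M ^ (n f * cornerExp a b s c) * Real.exp (δ * (M ^ (-(2 * b * n f)) * N f)) else 1)
    (fun f => by
      split_ifs
      · exact one_le_cornerBound_factor ha hb hM hδ hn hN s c f
      · exact le_rfl) f
  simp only [if_pos hf] at h
  exact h

/-- Exchanging the products collects the factors by face: the powers of `M` add up to `faceExp`, and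
each corner spends a share `δ` of the decay. -/
theorem prod_cornerBound_le (hM : 1 < M) (hδ : 0 < δ) (hcard : δ * Fintype.card G.Corner ≤ 1 / 2)
    (hN : ∀ f, 0 ≤ N f) :
    ∏ c : G.Corner, ∏ s, cornerBound a b M δ n N s c ≤
      ∏ f, (M ^ (n f * faceExp a b f) * Real.exp (1 / 2 * (M ^ (-(2 * b * n f)) * N f))) := by
  classical
  have hM0 : 0 < M := by linarith
  simp only [cornerBound]
  rw [Finset.prod_congr rfl fun c _ => Finset.prod_comm, Finset.prod_comm]
  refine Finset.prod_le_prod (fun f _ => Finset.prod_nonneg fun c _ => Finset.prod_nonneg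
    fun s _ => by split_ifs <;> positivity) fun f _ => ?_
  have hNf := hN f
  -- Corners off the face are charged the exponential as well, which makes the number of shares
  -- `Fintype.card G.Corner`.
  have hs (c : G.Corner) : (∏ s, if f.Mem s (.inl c) then
      M ^ (n f * cornerExp a b s c) * Real.exp (δ * (M ^ (-(2 * b * n f)) * N f)) else 1) ≤
      M ^ (n f * if .inl c ∈ f.2.1.supp then cornerExp a b f.1 c else 0) *
        Real.exp (δ * (M ^ (-(2 * b * n f)) * N f)) := by
    rw [Finset.prod_eq_single f.1 (fun s _ hs => if_neg fun h => hs h.1.symm) (by simp)]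
    by_cases hc : .inl c ∈ f.2.1.supp
    · rw [if_pos (show f.Mem f.1 (.inl c) from ⟨rfl, hc⟩), if_pos hc]
    · rw [if_neg (fun h : f.Mem f.1 (.inl c) => hc h.2), if_neg hc, mul_zero, Real.rpow_zero,
        one_mul]
      exact Real.one_le_exp (by positivity)
  refine (Finset.prod_le_prod (fun c _ => Finset.prod_nonneg
    fun s _ => by split_ifs <;> positivity) fun c _ => hs c).trans ?_
  rw [Finset.prod_mul_distrib, ← Real.rpow_sum_of_pos hM0, ← Finset.mul_sum, Finset.prod_const,
    Finset.card_univ, ← Real.exp_nat_mul, ← mul_assoc, mul_comm _ δ]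
  unfold faceExp
  gcongr

end cornerBound

theorem enhanced_le_cornerExp {a b : ℝ} (ha : 0 < a) (hb : 0 < b) {s : Fin d} {c : G.Corner}
    (h : (G.kind c.1).IsEnhancedStrand s c.2) : 2 * a ≤ cornerExp a b s c := by
  unfold cornerExp
  rw [if_pos h]
  refine le_add_of_nonneg_right (Finset.sum_nonneg fun ξ _ => ?_)
  have := Xi.val_pos ha hb ξ
  split_ifs <;> linarith

theorem two_le_cornerExp {a b : ℝ} (ha : 0 < a) (hb : 0 < b) {s : Fin d} {c : G.Corner} {ξ : Xi}
    (hξ : ξ ∈ m.exponents) (h : (G.kind c.1).IsTwo ξ s) : 2 * ξ.val a b ≤ cornerExp a b s c := by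
  classical
  unfold cornerExp
  refine le_add_of_nonneg_of_le (by split_ifs <;> linarith) ?_
  refine le_trans (le_of_eq (if_pos h).symm) (Finset.single_le_sum
    (f := fun ξ => if (G.kind c.1).IsTwo ξ s then 2 * ξ.val a b else 0) (fun ξ _ => ?_) hξ)
  have := Xi.val_pos ha hb ξ
  split_ifs <;> linarith

/-- The bound on the summand of the amplitude: after the momenta in the vertex weights are absorbed
in half of the exponential decay, each face contributes according to its scale. -/
theorem exists_abs_integrand_le (G : FeynmanGraph m d) (D : ℕ) {a b mass M : ℝ} (ha : 0 < a)
    (hb : 0 < b) (hmass : 0 < mass) (hM : 1 < M) (g : Couplings) (R : ℝ) :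
    ∃ A : ℝ, 0 < A ∧ ∀ Pext : G.ExtLeg → Mom d D, (∀ x s i, |(Pext x s i : ℝ)| ≤ R) →
      ∀ (scale : G.L → ℕ) (low : G.IntFace Set.univ → G.L),
        (∀ f : G.IntFace Set.univ, Sum.inl (G.src (low f)) ∈ f.2.1.supp) → ∀ P : G.Config Pext, Conserved P.1 →
          |G.integrand a b mass (M ^ b) g scale P.1| ≤
            A * (∏ l, M ^ (-(2 * b * ((scale l : ℝ) + 1)))) *
              (∏ f, M ^ (((scale (low f) : ℝ) + 1) * faceExp a b f)) *
              ∏ f, Real.exp (-(1 / 2 * (M ^ (-(2 * b * ((scale (low f) : ℝ) + 1))) *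
                normPow b (P.1 (.inl (G.src (low f))) f.1)))) := by
  have hM0 : 0 < M := by linarith
  -- One share per corner uses at most half of the decay of a face; the `+ 1` covers a graph without
  -- corners.
  set δ : ℝ := 1 / (2 * (Fintype.card G.Corner + 1)) with hδdef
  have hδ : 0 < δ := by positivity
  have hcard : δ * Fintype.card G.Corner ≤ 1 / 2 := by
    rw [hδdef, div_mul_eq_mul_div, div_le_div_iff₀ (by positivity) (by norm_num)]
    linarith
  obtain ⟨C, hC1, hC⟩ := exists_normPow_bound D ha hb hδ R
  have hC0 : 0 < C := by linarith
  have hg := g.bound_pos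
  refine ⟨(M ^ (2 * b) * (1 + mass⁻¹)) ^ Fintype.card G.L *
    (g.bound ^ Fintype.card G.V * (C ^ d) ^ Fintype.card G.Corner), by positivity,
    fun Pext hPext scale low hlow P hP => ?_⟩
  set n : G.IntFace Set.univ → ℝ := fun f => (scale (low f) : ℝ) + 1 with hndef
  set N : G.IntFace Set.univ → ℝ := fun f => normPow b (P.1 (.inl (G.src (low f))) f.1) with hNdef
  have hn (f) : 0 ≤ n f := by positivity
  have hN (f) : 0 ≤ N f := normPow_nonneg _ _
  have hone := one_le_cornerBound ha hb hM hδ hn hN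
  have hmom (s : Fin d) (c : G.Corner) (ξ : Xi) (hξ : 2 * ξ.val a b ≤ cornerExp a b s c) :
      normPow (ξ.val a b) (P.1 (.inl c) s) ≤ C * cornerBound a b M δ n N s c := by
    rcases exists_intFace_or_open s (.inl c) with ⟨f, hf⟩ | ⟨y, hy⟩
    · rw [hP.eq_of_mem hf (hlow f)]
      refine ((hC ξ).1 M hM0 (n f) _).trans ?_
      refine mul_le_mul_of_nonneg_left (le_trans ?_ (le_cornerBound ha hb hM hδ hn hN hf)) hC0.le
      have := hn f
      gcongr
      exact hM.le
    · rw [hP.eq_of_reachable hy, P.2 y]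
      exact ((hC ξ).2 _ (hPext y s)).trans (le_mul_of_one_le_right hC0.le (hone s c))
  have hvertex (v : G.V) : |-(G.kind v).kernel a b g (fun j => P.1 (.inl ⟨v, j⟩))
      (fun j => P.1 (.inr ⟨v, j⟩))| ≤
      g.bound * ∏ j, ∏ s, C * cornerBound a b M δ n N s ⟨v, j⟩ := by
    have hY (s : Fin d) (j : Fin (G.kind v).arity) :
        1 ≤ C * cornerBound a b M δ n N s ⟨v, j⟩ :=
      one_le_mul_of_one_le_of_one_le hC1 (hone s _)
    have hw := (G.kind v).abs_weight_le a b g (fun j => P.1 (.inl ⟨v, j⟩))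
      (fun s j => C * cornerBound a b M δ n N s ⟨v, j⟩) hY
      (fun s j h => hmom s ⟨v, j⟩ .a (enhanced_le_cornerExp ha hb h))
      (fun ξ hξ s j h => hmom s ⟨v, j⟩ ξ (two_le_cornerExp ha hb hξ h))
    refine le_trans ?_ hw
    unfold VertexKind.kernel
    rw [abs_neg]
    split_ifs
    · exact le_rfl
    · rw [abs_zero]
      exact abs_nonneg _
  have hvertices : |∏ v, -(G.kind v).kernel a b g (fun j => P.1 (.inl ⟨v, j⟩))
      (fun j => P.1 (.inr ⟨v, j⟩))| ≤
      (g.bound ^ Fintype.card G.V * (C ^ d) ^ Fintype.card G.Corner) *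
        ∏ f, (M ^ (n f * faceExp a b f) * Real.exp (1 / 2 * (M ^ (-(2 * b * n f)) * N f))) := by
    rw [Finset.abs_prod]
    refine (Finset.prod_le_prod (fun _ _ => abs_nonneg _) fun v _ => hvertex v).trans ?_
    rw [Finset.prod_mul_distrib, Finset.prod_const, Finset.card_univ, mul_assoc,
      ← Fintype.prod_sigma (fun c : G.Corner => ∏ s, C * cornerBound a b M δ n N s c)]
    refine mul_le_mul_of_nonneg_left ?_ (by positivity)
    simp only [Finset.prod_mul_distrib (f := fun _ => C), Finset.prod_const, Finset.card_univ,
      Fintype.card_fin]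
    rw [Finset.prod_mul_distrib (f := fun _ => C ^ d), Finset.prod_const, Finset.card_univ]
    exact mul_le_mul_of_nonneg_left (prod_cornerBound_le hM hδ hcard hN) (by positivity)
  have hlines := prod_propagator_le (a := a) hM hb hmass scale P.1 hlow
  rw [integrand, abs_mul]
  refine (mul_le_mul hlines hvertices (abs_nonneg _) (by positivity)).trans (le_of_eq ?_)
  rw [Finset.prod_mul_distrib]
  have hexp : (∏ f, Real.exp (-(M ^ (-(2 * b * n f)) * N f))) *
      ∏ f, Real.exp (1 / 2 * (M ^ (-(2 * b * n f)) * N f)) =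
      ∏ f, Real.exp (-(1 / 2 * (M ^ (-(2 * b * n f)) * N f))) := by
    rw [← Finset.prod_mul_distrib]
    refine Finset.prod_congr rfl fun f _ => ?_
    rw [← Real.exp_add]
    congr 1
    ring
  rw [← hexp]
  ring

/-- The power counting bound, uniform over finite sets of configurations. -/
theorem exists_sum_abs_integrand_le (G : FeynmanGraph m d) (D : ℕ) {a b mass M : ℝ} (ha : 0 < a)
    (hb : 0 < b) (hmass : 0 < mass) (hM : 1 < M) (g : Couplings) (R : ℝ) :
    ∃ κ : ℝ, 0 < κ ∧ ∀ Pext : G.ExtLeg → Mom d D, (∀ x s i, |(Pext x s i : ℝ)| ≤ R) →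
      ∀ (Λ : ℕ) (scale : G.L → ℕ), (∀ l, scale l ≤ Λ) → ∀ S : Finset (G.Config Pext),
        ∑ P ∈ S, |G.integrand a b mass (M ^ b) g scale P.1| ≤
          κ * ∏ i ∈ Finset.range (Λ + 1), ∏ k : G.Component scale i,
            M ^ G.degree D a b (G.componentLines scale i k) := by
  classical
  have hM0 : 0 < M := by linarith
  obtain ⟨A, hA, hint⟩ := exists_abs_integrand_le G D ha hb hmass hM g R
  obtain ⟨C, hC1, hC⟩ := sum_exp_normPow_le D hb
  have hC0 : 0 < C := by linarith
  refine ⟨A * C ^ Fintype.card (G.IntFace Set.univ), by positivity,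
    fun Pext hPext Λ scale hΛ S => ?_⟩
  choose low _ hlow hmin using fun f : G.IntFace Set.univ => f.exists_lowest_line scale
  have hmin' (f : G.IntFace Set.univ) (l : G.L) (hl : .inl (G.src l) ∈ f.2.1.supp) :
      scale (low f) ≤ scale l := hmin f l (Set.mem_univ l) hl
  set X : ℝ := A * (∏ l, M ^ (-(2 * b * ((scale l : ℝ) + 1)))) *
    (∏ f, M ^ (((scale (low f) : ℝ) + 1) * faceExp a b f)) with hX
  have hX0 : 0 ≤ X := by positivity
  set w : G.IntFace Set.univ → (Fin D → ℤ) → ℝ := fun f q =>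
    Real.exp (-(1 / 2 * (M ^ (-(2 * b * ((scale (low f) : ℝ) + 1))) * normPow b q))) with hw
  set φ : G.Config Pext → G.IntFace Set.univ → Fin D → ℤ :=
    fun P f => P.1 (.inl (G.src (low f))) f.1 with hφ
  -- Configurations that violate a Kronecker delta contribute zero.
  have hfilter : ∑ P ∈ S, |G.integrand a b mass (M ^ b) g scale P.1| =
      ∑ P ∈ S.filter (fun P => Conserved P.1), |G.integrand a b mass (M ^ b) g scale P.1| := by
    rw [Finset.sum_filter_of_ne]
    intro P _ hne
    exact conserved_of_integrand_ne_zero (abs_ne_zero.1 hne)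
  calc ∑ P ∈ S, |G.integrand a b mass (M ^ b) g scale P.1|
      ≤ ∑ P ∈ S.filter (fun P => Conserved P.1), X * ∏ f, w f (φ P f) := by
        rw [hfilter]
        exact Finset.sum_le_sum fun P hP =>
          hint Pext hPext scale low hlow P (Finset.mem_filter.1 hP).2
    -- On conserved configurations `φ` is injective, so the sum becomes one over independent face
    -- momenta.
    _ = X * ∑ q ∈ (S.filter (fun P => Conserved P.1)).image φ, ∏ f, w f (q f) := by
        rw [← Finset.mul_sum, Finset.sum_image]
        intro P hP Q hQ hPQ
        exact Conserved.config_ext (Finset.mem_filter.1 hP).2 (Finset.mem_filter.1 hQ).2 hlow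
          fun f => congrFun hPQ f
    _ ≤ X * ∏ f : G.IntFace Set.univ, C * M ^ (D * ((scale (low f) : ℝ) + 1)) := by
        refine mul_le_mul_of_nonneg_left ?_ hX0
        exact sum_prod_le_prod w (fun _ _ => (Real.exp_pos _).le) _
          (fun f T => hC M hM _ (by positivity) T) _
    _ = A * C ^ Fintype.card (G.IntFace Set.univ) *
          M ^ (-(∑ l, 2 * b * ((scale l : ℝ) + 1)) +
            ∑ f, ((scale (low f) : ℝ) + 1) * (D + faceExp a b f)) := by
        rw [Finset.prod_mul_distrib, Finset.prod_const, Finset.card_univ, hX,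
          ← Real.rpow_sum_of_pos hM0, ← Real.rpow_sum_of_pos hM0, ← Real.rpow_sum_of_pos hM0]
        have hsum : ∑ f, ((scale (low f) : ℝ) + 1) * (D + faceExp a b f) =
            ∑ f, ((scale (low f) : ℝ) + 1) * faceExp a b f +
              ∑ f : G.IntFace Set.univ, D * ((scale (low f) : ℝ) + 1) := by
          rw [← Finset.sum_add_distrib]
          exact Finset.sum_congr rfl fun f _ => by ring
        rw [hsum, Real.rpow_add hM0, Real.rpow_add hM0, ← Finset.sum_neg_distrib]
        ring
    _ ≤ A * C ^ Fintype.card (G.IntFace Set.univ) *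
          M ^ (∑ i ∈ Finset.range (Λ + 1), ∑ k : G.Component scale i,
            G.degree D a b (G.componentLines scale i k)) := by
        gcongr
        · exact hM.le
        · exact sum_degree_ge ha hb scale hΛ low hmin'
    _ = _ := by
        rw [Real.rpow_sum_of_pos hM0]
        simp only [Real.rpow_sum_of_pos hM0]

end FeynmanGraph
end EnhancedTensor
end

/-! ### Absolute convergence and the bound on the amplitude -/

open EnhancedTensor in
theorem mainTheorem5 (m : Model) (d D : ℕ) (a b mass M : ℝ) (ha : 0 < a) (hb : 0 < b)
    (hmass : 0 < mass) (hM : 1 < M) (hab : m.Condition a b) (g : Couplings)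
    (G : FeynmanGraph m d) (R : ℝ) :
    ∃ κ : ℝ, 0 < κ ∧ ∀ Pext : G.ExtLeg → Mom d D, (∀ x s i, |(Pext x s i : ℝ)| ≤ R) →
      ∀ (Λ : ℕ) (scale : G.L → ℕ), (∀ l, scale l ≤ Λ) →
        Summable (fun P : G.Config Pext => G.integrand a b mass (M ^ b) g scale P.1) ∧
        |G.amplitude a b mass (M ^ b) g scale Pext| ≤
          κ * ∏ i ∈ Finset.range (Λ + 1), ∏ k : G.Component scale i,
            M ^ G.degree D a b (G.componentLines scale i k) := by
  obtain ⟨κ, hκ, h⟩ := G.exists_sum_abs_integrand_le D ha hb hmass hM g R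
  refine ⟨κ, hκ, fun Pext hPext Λ scale hΛ => ?_⟩
  have hS := h Pext hPext Λ scale hΛ
  -- The bound is uniform over finite sets of configurations, so it gives both convergence and the
  -- estimate of the series.
  have habs : Summable fun P : G.Config Pext => |G.integrand a b mass (M ^ b) g scale P.1| :=
    summable_of_sum_le (fun _ => abs_nonneg _) hS
  refine ⟨habs.of_abs, ?_⟩
  have hle := habs.tsum_le_of_sum_le hS
  simp only [← Real.norm_eq_abs] at habs hle
  have htri := norm_tsum_le_tsum_norm habs
  rw [FeynmanGraph.amplitude, ← Real.norm_eq_abs]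
  exact htri.trans hle
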